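/- Let $F$ be any field, let $n$ be a natural number, and let $G$ be a subgroup of $\mathrm{GL}(n,F)$ that is completely reducible, i.e. every $G$-invariant subspace of $F^n$ has a $G$-invariant complement. Then the following are equivalent: (i) $G$ is solvable-by-finite; (ii) $G$ is nilpotent-by-finite; (iii) $G$ is abelian-by-finite. Here $G$ is called solvable-by-finite (respectively nilpotent-by-finite, abelian-by-finite) if it has a normal subgroup of finite index that is solvable (respectively nilpotent, abelian). -/

import Mathlib

namespace LinearGroup

/-- A group is solvable-by-finite if it has a solvable normal subgroup of finite index. -/
def IsSolvableByFinite (G : Type*) [Group G] : Prop :=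
  ∃ N : Subgroup G, N.Normal ∧ N.FiniteIndex ∧ Group.IsSolvable N

/-- A group is nilpotent-by-finite if it has a nilpotent normal subgroup of finite index. -/
def IsNilpotentByFinite (G : Type*) [Group G] : Prop :=
  ∃ N : Subgroup G, N.Normal ∧ N.FiniteIndex ∧ Group.IsNilpotent N

/-- A group is abelian-by-finite if it has an abelian normal subgroup of finite index. -/
def IsAbelianByFinite (G : Type*) [Group G] : Prop :=
  ∃ N : Subgroup G, N.Normal ∧ N.FiniteIndex ∧ IsMulCommutative N

/-- The natural representation of a linear group `G ≤ GL(n, F)` on the column space `Fⁿ`: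
`g` acts as `v ↦ g *ᵥ v`. -/
def naturalRep {F : Type*} [Field F] {n : ℕ}
    (G : Subgroup (Matrix.GeneralLinearGroup (Fin n) F)) :
    Representation F G (Fin n → F) where
  toFun g := Matrix.mulVecLin (g : Matrix.GeneralLinearGroup (Fin n) F).val
  map_one' := by simp [Module.End.one_eq_id]
  map_mul' g h := by simp [Matrix.mulVecLin_mul, Module.End.mul_eq_comp]

/-- A linear group is completely reducible if every `G`-invariant subspace of `Fⁿ` has a
`G`-invariant complement. -/
def IsCompletelyReducible {F : Type*} [Field F] {n : ℕ}
    (G : Subgroup (Matrix.GeneralLinearGroup (Fin n) F)) : Prop :=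
  (naturalRep G).IsSemisimpleRepresentation

end LinearGroup

/-! The content is solvable-by-finite implies abelian-by-finite. Subspaces on which some
finite-index subgroup acts commutatively are closed under sums and translates, so there is a
greatest one, `M`, and it is `G`-stable. If its invariant complement were nonzero, it would contain
a minimal `N`-stable subspace, with `N` solvable of finite index. It thus suffices that irreducible
solvable groups are virtually commutative, since that subspace would then lie in `M`.

For those, induct on dimension. If a finite-index subgroup acts reducibly, a proper minimal stable
subspace makes `M` nonzero, hence everything. Otherwise pass to the faithful quotient and apply
`exists_finiteIndex_le_centralizer`: take `A` maximal abelian normal and `C` its centralizer. The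
reduced algebra `F[A]` has finitely many endomorphisms, so `C` has finite index and is irreducible.
Take `B` maximal normal with `A ≤ B ≤ C` and `⁅B, B⁆ ≤ A`. Then `B / A` is finite by linear
independence, solvability gives `centralizer B ≤ A`, and `C` permutes finite sets of roots in `B`,
so `centralizer B`, hence `A`, has finite index. -/

namespace LinearGroup

open Subgroup
open scoped commutatorElement

/-! ### Group-theoretic preliminaries -/

section GroupTheory

variable {G : Type*} [Group G]

theorem finiteIndex_of_eq_imp_mem {X : Type*} [Finite X] (E : Subgroup G) (f : G → X)
    (hf : ∀ g h, f g = f h → g⁻¹ * h ∈ E) : E.FiniteIndex := by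
  have : Finite (G ⧸ E) := by
    refine Finite.of_injective (fun q : G ⧸ E => f q.out) fun q r h => ?_
    rw [← q.out_eq', ← r.out_eq']
    exact QuotientGroup.eq.2 (hf _ _ h)
  exact finiteIndex_of_finite_quotient

theorem finiteIndex_of_subgroupOf {E C : Subgroup G} [C.FiniteIndex]
    (h : (E.subgroupOf C).FiniteIndex) : E.FiniteIndex := by
  have h2 : (E ⊓ C).FiniteIndex := by
    refine ⟨?_⟩
    rw [← relIndex_top_right, ← relIndex_inf_mul_relIndex]
    simp only [relIndex_top_right, inf_top_eq]
    exact mul_ne_zero h.index_ne_zero FiniteIndex.index_ne_zero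
  exact finiteIndex_of_le (inf_le_left : E ⊓ C ≤ E)

/-- Between normal subgroups `D ≤ C` there is a maximal normal subgroup of `G` that is abelian
modulo `D`. -/
theorem exists_maximal_normal_commutator_le (D C : Subgroup G) [hD : D.Normal] (hDC : D ≤ C) :
    ∃ B : Subgroup G, B.Normal ∧ D ≤ B ∧ B ≤ C ∧ ⁅B, B⁆ ≤ D ∧
      ∀ B' : Subgroup G, B'.Normal → B ≤ B' → B' ≤ C → ⁅B', B'⁆ ≤ D → B' ≤ B := by
  obtain ⟨B, hDB, hB⟩ := zorn_le_nonempty₀ {B : Subgroup G | B.Normal ∧ B ≤ C ∧ ⁅B, B⁆ ≤ D} (by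
      intro c hc hchain y hy
      have hmem : ∀ x, x ∈ sSup c ↔ ∃ s ∈ c, x ∈ s := fun x =>
        mem_sSup_of_directedOn ⟨y, hy⟩ hchain.directedOn
      refine ⟨sSup c, ⟨⟨fun x hx g => ?_⟩, sSup_le fun s hs => (hc hs).2.1, ?_⟩,
        fun s hs => le_sSup hs⟩
      · obtain ⟨s, hs, hxs⟩ := (hmem x).1 hx
        exact (hmem _).2 ⟨s, hs, (hc hs).1.conj_mem x hxs g⟩
      · rw [commutator_le]
        intro a ha b hb
        obtain ⟨s, hs, has⟩ := (hmem a).1 ha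
        obtain ⟨t, ht, hbt⟩ := (hmem b).1 hb
        obtain ⟨u, hu, hsu, htu⟩ := hchain.directedOn s hs t ht
        exact (hc hu).2.2 (commutator_mem_commutator (hsu has) (htu hbt)))
    D ⟨hD, hDC, commutator_le_self D⟩
  exact ⟨B, hB.prop.1, hDB, hB.prop.2.1, hB.prop.2.2,
    fun B' h1 h2 h3 h4 => hB.le_of_ge ⟨h1, h3, h4⟩ h2⟩

/-- Intersect `E` with the last term of the derived series for which the intersection is not inside
`A`; commutators fall into the next term. -/
theorem exists_normal_commutator_le [Group.IsSolvable G] {E A : Subgroup G} [E.Normal]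
    (h : ¬ E ≤ A) : ∃ D : Subgroup G, D.Normal ∧ D ≤ E ∧ ¬ D ≤ A ∧ ⁅D, D⁆ ≤ A := by
  classical
  obtain ⟨n, hn⟩ := ‹Group.IsSolvable G›.solvable
  have hex : ∃ k, E ⊓ derivedSeries G k ≤ A := ⟨n, by rw [hn, inf_bot_eq]; exact bot_le⟩
  obtain ⟨k, hk⟩ : ∃ k, Nat.find hex = k + 1 := by
    refine Nat.exists_eq_succ_of_ne_zero fun h0 => h ?_
    have := Nat.find_spec hex
    rwa [h0, derivedSeries_zero, inf_top_eq] at this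
  have hnormal := derivedSeries_normal G k
  refine ⟨E ⊓ derivedSeries G k, inferInstance, inf_le_left,
    Nat.find_min hex (by omega), ?_⟩
  have hs := Nat.find_spec hex
  rw [hk] at hs
  refine le_trans (le_inf ?_ ?_) hs
  · exact (commutator_mono inf_le_left inf_le_left).trans (commutator_le_self E)
  · exact commutator_mono inf_le_right inf_le_right

theorem commutator_sup_le_of_le_centralizer {A B D : Subgroup G} [B.Normal]
    (hDB : D ≤ centralizer (B : Set G)) (hB : ⁅B, B⁆ ≤ A) (hD : ⁅D, D⁆ ≤ A) :
    ⁅B ⊔ D, B ⊔ D⁆ ≤ A := by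
  have hcomm {b d : G} (hb : b ∈ B) (hd : d ∈ D) : b * d = d * b :=
    mem_centralizer_iff.1 (hDB hd) b hb
  rw [commutator_le]
  intro x hx y hy
  obtain ⟨b, hb, d, hd, rfl⟩ := mem_sup_of_normal_left.1 hx
  obtain ⟨c, hc, f, hf, rfl⟩ := mem_sup_of_normal_left.1 hy
  have h1 : ⁅b * d, c * f⁆ = ⁅b, c⁆ * ⁅d, f⁆ := by
    calc ⁅b * d, c * f⁆ = b * (d * c) * f * d⁻¹ * (b⁻¹ * f⁻¹) * c⁻¹ := by
          simp only [commutatorElement_def]; group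
      _ = b * c * (⁅d, f⁆ * (c * b)⁻¹) := by
          rw [← hcomm hc hd, hcomm (inv_mem hb) (inv_mem hf), commutatorElement_def]; group
      _ = ⁅b, c⁆ * ⁅d, f⁆ := by
          rw [← hcomm (inv_mem (mul_mem hc hb)) (commutator_le_self D
            (commutator_mem_commutator hd hf)), commutatorElement_def b c]; group
  rw [h1]
  exact mul_mem (hB (commutator_mem_commutator hb hc)) (hD (commutator_mem_commutator hd hf))

/-- As `A` is central, two solutions in one coset of `A` differ by an element of `A` killed by `e`.
-/
theorem finite_setOf_pow_eq (A : Subgroup G) (hA : A ≤ center G) [A.FiniteIndex] (e : ℕ)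
    (hT : {a | a ∈ A ∧ a ^ e = 1}.Finite) (s : G) : {x : G | x ^ e = s}.Finite := by
  have hfib : ∀ q : G ⧸ A, {x : G | x ^ e = s ∧ (x : G ⧸ A) = q}.Finite := by
    intro q
    rcases Set.eq_empty_or_nonempty {x : G | x ^ e = s ∧ (x : G ⧸ A) = q} with h | ⟨y, hy, hyq⟩
    · rw [h]; exact Set.finite_empty
    · refine (hT.image (fun a => y * a)).subset ?_
      rintro x ⟨hx, hxq⟩
      have hmem : y⁻¹ * x ∈ A := QuotientGroup.eq.1 (hyq.trans hxq.symm)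
      refine ⟨y⁻¹ * x, ⟨hmem, ?_⟩, by simp⟩
      have hcomm : Commute y (y⁻¹ * x) := mem_center_iff.1 (hA hmem) y
      have := hcomm.mul_pow e
      rw [mul_inv_cancel_left, hx, hy] at this
      exact left_eq_mul.1 this
  refine (Set.finite_iUnion hfib).subset fun x hx => ?_
  exact Set.mem_iUnion.2 ⟨x, hx, rfl⟩

end GroupTheory

/-! ### Irreducible action of all finite-index subgroups -/

section Irreducible

variable {F G V : Type*} [Field F] [Group G] [AddCommGroup V] [Module F V]

/-- The subspace `W` is stable under the subgroup `H`. -/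
def IsStable (ρ : Representation F G V) (H : Subgroup G) (W : Submodule F V) : Prop :=
  ∀ h ∈ H, ∀ w ∈ W, ρ h w ∈ W

/-- The only subspaces stable under `H` are `⊥` and `⊤`. -/
def ActsIrreducibly (ρ : Representation F G V) (H : Subgroup G) : Prop :=
  ∀ W, IsStable ρ H W → W = ⊥ ∨ W = ⊤

theorem apply_mul_apply_inv (ρ : Representation F G V) (g : G) : ρ g * ρ g⁻¹ = 1 := by
  rw [← map_mul, mul_inv_cancel, map_one]

theorem apply_inv_mul_apply (ρ : Representation F G V) (g : G) : ρ g⁻¹ * ρ g = 1 := by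
  rw [← map_mul, inv_mul_cancel, map_one]

/-- Conjugation by `ρ g` as an algebra endomorphism of `End V`. -/
def conjHom (ρ : Representation F G V) (g : G) : Module.End F V →ₐ[F] Module.End F V :=
  AlgHom.ofLinearMap (LinearMap.mulLeft F (ρ g) ∘ₗ LinearMap.mulRight F (ρ g⁻¹))
    (by simp [apply_mul_apply_inv]) fun x y => by
      simp only [LinearMap.comp_apply, LinearMap.mulLeft_apply, LinearMap.mulRight_apply]
      calc ρ g * (x * y * ρ g⁻¹) = ρ g * x * 1 * y * ρ g⁻¹ := by simp only [mul_one, mul_assoc]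
        _ = _ := by rw [← apply_inv_mul_apply ρ g]; simp only [mul_assoc]

theorem conjHom_apply (ρ : Representation F G V) (g : G) (x : Module.End F V) :
    conjHom ρ g x = ρ g * x * ρ g⁻¹ := by
  simp [conjHom, mul_assoc]

theorem conjHom_rep (ρ : Representation F G V) (g h : G) :
    conjHom ρ g (ρ h) = ρ (g * h * g⁻¹) := by
  simp [conjHom_apply]

theorem conjHom_mul_apply (ρ : Representation F G V) (g : G) (x : Module.End F V) (v : V) :
    conjHom ρ g x (ρ g v) = ρ g (x v) := by
  rw [conjHom_apply, Module.End.mul_apply, Module.End.mul_apply, ← Module.End.mul_apply (ρ g⁻¹),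
    apply_inv_mul_apply, Module.End.one_apply]

/-- The enveloping algebra of a subgroup. -/
abbrev envelope (ρ : Representation F G V) (A : Subgroup G) : Subalgebra F (Module.End F V) :=
  Algebra.adjoin F (ρ '' A)

theorem rep_mem_envelope (ρ : Representation F G V) {A : Subgroup G} {a : G} (ha : a ∈ A) :
    ρ a ∈ envelope ρ A :=
  Algebra.subset_adjoin ⟨a, ha, rfl⟩

theorem conjHom_mem_envelope (ρ : Representation F G V) (A : Subgroup G) [hA : A.Normal] (g : G)
    {x : Module.End F V} (hx : x ∈ envelope ρ A) : conjHom ρ g x ∈ envelope ρ A := by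
  have h : (envelope ρ A).map (conjHom ρ g) ≤ envelope ρ A := by
    rw [AlgHom.map_adjoin, Algebra.adjoin_le_iff]
    rintro _ ⟨_, ⟨a, ha, rfl⟩, rfl⟩
    rw [conjHom_rep]
    exact rep_mem_envelope ρ (hA.conj_mem a ha g)
  exact h ⟨x, hx, rfl⟩

theorem commute_of_mem_envelope (ρ : Representation F G V) {A : Subgroup G} {c : G}
    (hc : c ∈ centralizer (A : Set G)) {x : Module.End F V} (hx : x ∈ envelope ρ A) :
    Commute (ρ c) x := by
  have h : envelope ρ A ≤ Subalgebra.centralizer F {ρ c} := by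
    rw [Algebra.adjoin_le_iff]
    rintro _ ⟨a, ha, rfl⟩
    rw [SetLike.mem_coe, Subalgebra.mem_centralizer_iff]
    rintro _ rfl
    rw [← map_mul, ← map_mul, mem_centralizer_iff.1 hc a ha]
  exact Subalgebra.mem_centralizer_iff F |>.1 (h hx) _ rfl

/-- The enveloping algebra of a commutative subgroup is commutative. -/
abbrev envelopeCommRing (ρ : Representation F G V) {A : Subgroup G}
    (hA : A ≤ centralizer (A : Set G)) : CommRing (envelope ρ A) :=
  { (envelope ρ A).toRing with
    mul_comm := (Algebra.isMulCommutative_adjoin F (by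
      rintro _ ⟨a, ha, rfl⟩ _ ⟨b, hb, rfl⟩
      rw [← map_mul, ← map_mul, mem_centralizer_iff.1 (hA hb) a ha])).is_comm.comm }

/-- Conjugation preserves the nilradical `N` of the envelope, so `N • V` is stable. Nakayama
excludes `N • V = V`, so `N` kills `V`. -/
theorem isReduced_envelope [FiniteDimensional F V] [Nontrivial V] (ρ : Representation F G V)
    (hρ : ActsIrreducibly ρ ⊤) {A : Subgroup G} [A.Normal] (hA : A ≤ centralizer (A : Set G)) :
    IsReduced (envelope ρ A) := by
  let := envelopeCommRing ρ hA
  have hfin : Module.Finite (envelope ρ A) V := Module.Finite.of_restrictScalars_finite F _ V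
  let N : Ideal (envelope ρ A) := nilradical _
  let U : Submodule (envelope ρ A) V := N • ⊤
  have hU : IsStable ρ ⊤ (U.restrictScalars F) := by
    intro g _ w hw
    rw [Submodule.restrictScalars_mem] at hw ⊢
    induction hw using Submodule.smul_induction_on' with
    | smul x hx v _ =>
      have h1 : (⟨conjHom ρ g x, conjHom_mem_envelope ρ A g x.2⟩ : envelope ρ A) ∈ N := by
        obtain ⟨n, hn⟩ := hx
        refine ⟨n, Subtype.ext ?_⟩
        have h2 : (x : Module.End F V) ^ n = 0 := congrArg Subtype.val hn
        have h3 := map_pow (conjHom ρ g) (x : Module.End F V) n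
        rw [h2, map_zero] at h3
        exact h3.symm
      have h4 := Submodule.smul_mem_smul h1 (Submodule.mem_top : ρ g v ∈ _)
      have h5 : (⟨conjHom ρ g x, conjHom_mem_envelope ρ A g x.2⟩ : envelope ρ A) • ρ g v =
        ρ g (x • v) := conjHom_mul_apply ρ g x v
      rwa [h5] at h4
    | add x _ y _ hx hy => rw [map_add]; exact add_mem hx hy
  rcases hρ _ hU with h | h
  · refine ⟨fun x hx => Subtype.ext (LinearMap.ext fun v => ?_)⟩
    have h1 : x • v ∈ U := Submodule.smul_mem_smul hx (Submodule.mem_top : v ∈ _)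
    have h2 : x • v ∈ U.restrictScalars F := h1
    rw [h] at h2
    exact (Submodule.mem_bot F).1 h2
  · exfalso
    have h1 : (⊤ : Submodule (envelope ρ A) V) ≤ N • ⊤ := fun v _ =>
      (h.symm ▸ Submodule.mem_top : v ∈ U.restrictScalars F)
    have h2 := Submodule.eq_bot_of_le_smul_of_le_jacobson_bot N ⊤ hfin.fg_top h1
      (Ideal.jacobson_bot (R := envelope ρ A) ▸ nilradical_le_jacobson _)
    exact top_ne_bot h2

/-- A reduced Artinian ring embeds in the product of its finitely many residue fields, and each
receives only finitely many homomorphisms from `R`. -/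
theorem finite_algHom_of_isReduced (R : Type*) [CommRing R] [Algebra F R] [FiniteDimensional F R]
    [IsReduced R] : Finite (R →ₐ[F] R) := by
  have : IsArtinianRing R := IsArtinianRing.of_finite F R
  have h (m : MaximalSpectrum R) : Finite (R →ₐ[F] R ⧸ m.asIdeal) := by
    infer_instance
  refine Finite.of_injective (fun (f : R →ₐ[F] R) (m : MaximalSpectrum R) =>
    (Ideal.Quotient.mkₐ F m.asIdeal).comp f) fun f g hfg => AlgHom.ext fun x => ?_
  have h1 : f x - g x ∈ Ring.jacobson R := by
    rw [Ring.jacobson_eq_sInf_isMaximal, Ideal.mem_sInf]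
    intro I hI
    have := DFunLike.congr_fun (congrFun hfg ⟨I, hI⟩) x
    exact Ideal.Quotient.eq.1 this
  rw [Ring.jacobson_eq_nilradical_of_krullDimLE_zero R, nilradical_eq_zero] at h1
  exact sub_eq_zero.1 h1

/-- `G` acts by conjugation on the envelope through a finite set of endomorphisms; by faithfulness,
elements acting alike differ by an element centralizing `A`. -/
theorem finiteIndex_centralizer [FiniteDimensional F V] [Nontrivial V]
    (ρ : Representation F G V) (hinj : Function.Injective ρ)
    (hρ : ActsIrreducibly ρ ⊤) {A : Subgroup G} [A.Normal] (hA : A ≤ centralizer (A : Set G)) :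
    (centralizer (A : Set G)).FiniteIndex := by
  let := envelopeCommRing ρ hA
  have := isReduced_envelope ρ hρ hA
  have : Finite (envelope ρ A →ₐ[F] envelope ρ A) := finite_algHom_of_isReduced _
  refine finiteIndex_of_eq_imp_mem _ (fun g => ((conjHom ρ g).comp (envelope ρ A).val).codRestrict
    (envelope ρ A) fun x => conjHom_mem_envelope ρ A g x.2) fun g h hgh => ?_
  rw [mem_centralizer_iff]
  intro a ha
  have h1 := congrArg Subtype.val (DFunLike.congr_fun hgh ⟨ρ a, rep_mem_envelope ρ ha⟩)
  have h2 : conjHom ρ g (ρ a) = conjHom ρ h (ρ a) := h1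
  rw [conjHom_rep, conjHom_rep] at h2
  have h3 := hinj h2
  calc a * (g⁻¹ * h) = g⁻¹ * (g * a * g⁻¹) * h := by group
    _ = g⁻¹ * h * a := by rw [h3]; group

/-- Schur's lemma. -/
theorem eq_zero_or_injective_of_commute {ρ : Representation F G V} {C : Subgroup G}
    (hC : ActsIrreducibly ρ C) {x : Module.End F V} (hx : ∀ c ∈ C, Commute (ρ c) x) :
    x = 0 ∨ Function.Injective x := by
  have : IsStable ρ C (LinearMap.ker x) := by
    intro c hc w hw
    rw [LinearMap.mem_ker] at hw ⊢
    rw [← Module.End.mul_apply, ← (hx c hc).eq, Module.End.mul_apply, hw, map_zero]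
  rcases hC _ this with h | h
  · exact Or.inr (LinearMap.ker_eq_bot.1 h)
  · exact Or.inl (LinearMap.ker_eq_top.1 h)

theorem isDomain_envelope [Nontrivial V] {ρ : Representation F G V} {A : Subgroup G}
    (hC : ActsIrreducibly ρ (centralizer (A : Set G))) : IsDomain (envelope ρ A) := by
  have : NoZeroDivisors (envelope ρ A) := by
    refine ⟨fun {x y} hxy => ?_⟩
    refine (eq_zero_or_injective_of_commute hC
      fun c hc => commute_of_mem_envelope ρ hc x.2).imp Subtype.ext fun h =>
        Subtype.ext (LinearMap.ext fun v => h ?_)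
    have := LinearMap.congr_fun (congrArg Subtype.val hxy) v
    simpa using this
  exact NoZeroDivisors.to_isDomain _

/-- Elements with pairwise distinct commutator characters are linearly independent over the
commutant. -/
theorem eq_zero_of_sum_mul_eq_zero {ρ : Representation F G V} (hinj : Function.Injective ρ)
    {C : Subgroup G}
    (hC : ActsIrreducibly ρ C) {A B : Subgroup G} (hBC : B ≤ C) (hAC : A ≤ C)
    (hCA : C ≤ centralizer (A : Set G))
    (hBA : ⁅B, B⁆ ≤ A) (hZ : B ⊓ centralizer (B : Set G) ≤ A) {ι : Type*} (b : ι → G)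
    (hb : ∀ i, b i ∈ B) (hdist : ∀ i j, i ≠ j → (b i)⁻¹ * b j ∉ A) (s : Finset ι) :
    ∀ k : ι → Module.End F V, (∀ i, ∀ c ∈ C, Commute (ρ c) (k i)) →
      ∑ i ∈ s, k i * ρ (b i) = 0 → ∀ i ∈ s, k i = 0 := by
  classical
  induction s using Finset.induction_on with
  | empty => simp
  | insert j s hj ih =>
    intro k hk hsum
    have hA {a : G} (ha : a ∈ A) {c : G} (hc : c ∈ C) : Commute (ρ c) (ρ a) := by
      rw [Commute, SemiconjBy, ← map_mul, ← map_mul, mem_centralizer_iff.1 (hCA hc) a ha]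
    have hcomm (c : G) (hc : c ∈ B) (i : ι) : ⁅c, b i⁆ ∈ A :=
      hBA (commutator_mem_commutator hc (hb i))
    have hs : ∀ i ∈ s, k i = 0 := by
      intro i hi
      have hij : i ≠ j := fun h => hj (h ▸ hi)
      -- If no `c` separated them, `(b i)⁻¹ * b j` would centralize `B`, hence lie in `A` by `hZ`.
      obtain ⟨c, hc, hne⟩ : ∃ c ∈ B, ⁅c, b i⁆ ≠ ⁅c, b j⁆ := by
        by_contra! hall
        refine hdist i j hij (hZ (mem_inf.2 ⟨mul_mem (inv_mem (hb i)) (hb j), ?_⟩))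
        rw [mem_centralizer_iff]
        intro c hc
        have h1 := hall c hc
        have h2 : b i * c * (b i)⁻¹ = b j * c * (b j)⁻¹ := by
          have := congrArg (fun x => (c⁻¹ * x)⁻¹) h1
          simpa [commutatorElement_def, mul_assoc] using this
        calc c * ((b i)⁻¹ * b j) = (b i)⁻¹ * (b i * c * (b i)⁻¹) * b j := by group
          _ = (b i)⁻¹ * b j * c := by rw [h2]; group
      -- As for independence of characters: conjugate the relation by `c` and subtract `ρ ⁅c, b j⁆`
      -- times it, which cancels the `j` term.
      have key : ∑ l ∈ s, (k l * (ρ ⁅c, b l⁆ - ρ ⁅c, b j⁆)) * ρ (b l) = 0 := by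
        have h1 : ∑ l ∈ insert j s, (k l * (ρ ⁅c, b l⁆ - ρ ⁅c, b j⁆)) * ρ (b l) = 0 := by
          have e1 : ∑ l ∈ insert j s, k l * ρ ⁅c, b l⁆ * ρ (b l) = 0 := by
            have h2 := congrArg (conjHom ρ c) hsum
            rw [map_sum, map_zero] at h2
            rw [← h2]
            refine Finset.sum_congr rfl fun l _ => ?_
            rw [map_mul, conjHom_rep, conjHom_apply, (hk l c (hBC hc)).eq, mul_assoc (k l) (ρ c),
              apply_mul_apply_inv, mul_one, mul_assoc, ← map_mul, commutatorElement_def]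
            simp
          have e2 : ∑ l ∈ insert j s, k l * ρ ⁅c, b j⁆ * ρ (b l) = 0 := by
            have h2 := congrArg (ρ ⁅c, b j⁆ * ·) hsum
            simp only [mul_zero, Finset.mul_sum] at h2
            rw [← h2]
            refine Finset.sum_congr rfl fun l _ => ?_
            rw [← mul_assoc, (hk l _ (hAC (hcomm c hc j))).eq]
          simp only [mul_sub, sub_mul, Finset.sum_sub_distrib, e1, e2, sub_zero]
        rwa [Finset.sum_insert hj, sub_self, mul_zero, zero_mul, zero_add] at h1
      have h0 := ih _ (fun l d hd => (hk l d hd).mul_right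
        ((hA (hcomm c hc l) hd).sub_right (hA (hcomm c hc j) hd))) key i hi
      rcases eq_zero_or_injective_of_commute hC (hk i) with h | h
      · exact h
      · refine absurd (hinj (sub_eq_zero.1 (LinearMap.ext fun v => h ?_))) hne
        rw [← Module.End.mul_apply, h0]
        simp
    intro i hi
    rcases Finset.mem_insert.1 hi with rfl | h
    · rw [Finset.sum_insert hj, Finset.sum_eq_zero fun l hl => by rw [hs l hl, zero_mul],
        add_zero] at hsum
      rw [← mul_one (k i), ← apply_mul_apply_inv ρ (b i), ← mul_assoc, hsum, zero_mul]
    · exact hs i h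

/-- Representatives of the cosets of `A` in `B` are linearly independent in the finite-dimensional
space `End V`. -/
theorem finiteIndex_subgroupOf_of_center_le [FiniteDimensional F V] [Nontrivial V]
    {ρ : Representation F G V}
    (hinj : Function.Injective ρ) {C : Subgroup G}
    (hC : ActsIrreducibly ρ C) {A B : Subgroup G} (hBC : B ≤ C) (hAC : A ≤ C)
    (hCA : C ≤ centralizer (A : Set G))
    (hBA : ⁅B, B⁆ ≤ A) (hZ : B ⊓ centralizer (B : Set G) ≤ A) : (A.subgroupOf B).FiniteIndex := by
  have hli : LinearIndependent F (fun q : B ⧸ A.subgroupOf B => ρ (q.out : B)) := by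
    rw [linearIndependent_iff']
    intro s k hk i hi
    have h := eq_zero_of_sum_mul_eq_zero hinj hC hBC hAC hCA hBA hZ
      (fun q : B ⧸ A.subgroupOf B => ((q.out : B) : G)) (fun q => q.out.2) (fun q r hqr h => hqr (by
        rw [← q.out_eq', ← r.out_eq']
        exact QuotientGroup.eq.2 h)) s (fun q => algebraMap F _ (k q))
        (fun q c _ => (Algebra.commutes (k q) (ρ c)).symm)
        (by simpa only [Algebra.smul_def] using hk) i hi
    exact (map_eq_zero_iff _ (algebraMap F (Module.End F V)).injective).1 h
  have : Finite (B ⧸ A.subgroupOf B) := hli.finite_of_isNoetherian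
  exact finiteIndex_of_finite_quotient

/-- A faithful solvable group all of whose subgroups of finite index act irreducibly is
abelian-by-finite. -/
theorem exists_finiteIndex_le_centralizer [FiniteDimensional F V] [Nontrivial V]
    [Group.IsSolvable G] {ρ : Representation F G V} (hinj : Function.Injective ρ)
    (hρ : ∀ H : Subgroup G, H.FiniteIndex → ActsIrreducibly ρ H) :
    ∃ A : Subgroup G, A.FiniteIndex ∧ A ≤ centralizer (A : Set G) := by
  obtain ⟨A, hAn, -, -, hAA, hAmax⟩ := exists_maximal_normal_commutator_le (⊥ : Subgroup G) ⊤ le_top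
  rw [le_bot_iff, commutator_eq_bot_iff_le_centralizer] at hAA
  set C := centralizer (A : Set G) with hCdef
  have hCfin : C.FiniteIndex := finiteIndex_centralizer ρ hinj (hρ ⊤ inferInstance) hAA
  have hC := hρ C hCfin
  obtain ⟨B, hBn, hAB, hBC, hBA, hBmax⟩ := exists_maximal_normal_commutator_le A C hAA
  have hZ : B ⊓ centralizer (B : Set G) ≤ A := by
    refine hAmax _ inferInstance (le_inf hAB (le_centralizer_iff.1 hBC)) le_top ?_
    rw [le_bot_iff, commutator_eq_bot_iff_le_centralizer]
    exact inf_le_right.trans (centralizer_le (inf_le_left : B ⊓ centralizer (B : Set G) ≤ B))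
  have hBfin := finiteIndex_subgroupOf_of_center_le hinj hC hBC hAA le_rfl hBA hZ
  set E := centralizer (B : Set G) with hEdef
  have hEC : E ≤ C := centralizer_le hAB
  have hEA : E ≤ A := by
    by_contra hne
    obtain ⟨D, hDn, hDE, hDA, hDD⟩ := exists_normal_commutator_le hne
    -- `D` commutes with `B`, so `B ⊔ D` is still abelian modulo `A`; maximality of `B` gives `D ≤
    -- B`.
    refine hDA ((le_inf ?_ hDE).trans hZ)
    refine le_sup_right.trans (hBmax (B ⊔ D) inferInstance le_sup_left
      (sup_le hBC (hDE.trans hEC)) ?_)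
    exact commutator_sup_le_of_le_centralizer hDE hBA hDD
  refine ⟨A, ?_, hAA⟩
  let A' := A.subgroupOf B
  have hA'n : A'.Normal := inferInstance
  have hA'c : A' ≤ center B := fun x hx => mem_center_iff.2 fun y =>
    Subtype.ext (mem_centralizer_iff.1 (hBC y.2) x hx).symm
  let e := A'.index
  -- These are `e`-th roots of unity in the envelope of `A`, a domain by Schur's lemma.
  have hT : {a : B | a ∈ A' ∧ a ^ e = 1}.Finite := by
    let := envelopeCommRing ρ hAA
    have := isDomain_envelope hC
    have he : 0 < e := Nat.pos_of_ne_zero hBfin.index_ne_zero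
    refine Set.Finite.of_finite_image (f := fun a : B => ρ a) ?_
      fun a _ b _ hab => Subtype.ext (hinj hab)
    refine ((Polynomial.nthRootsFinset e (1 : envelope ρ A)).finite_toSet.image
      Subtype.val).subset ?_
    rintro _ ⟨a, ⟨haA, hae⟩, rfl⟩
    refine ⟨⟨ρ a, rep_mem_envelope ρ haA⟩, ?_, rfl⟩
    rw [Finset.mem_coe, Polynomial.mem_nthRootsFinset he]
    refine Subtype.ext ?_
    have h1 : ρ (a : G) ^ e = 1 := by
      rw [← map_pow, ← SubmonoidClass.coe_pow, hae, OneMemClass.coe_one, map_one]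
    exact h1
  have hS (s : B) : Finite {x : B // x ^ e = s} := finite_setOf_pow_eq A' hA'c e hT s
  -- Since `b ^ e` lies in `A`, which `C` centralizes, `C` moves `b` only among the finitely many
  -- `e`-th roots of `b ^ e`.
  have hconj (c : C) (b : B) :
      (⟨c * b * (c : G)⁻¹, hBn.conj_mem b b.2 c⟩ : B) ^ e = b ^ e := by
    have h1 : b ^ e ∈ A' := pow_index_mem A' b
    refine Subtype.ext ?_
    rw [SubmonoidClass.coe_pow, conj_pow, SubmonoidClass.coe_pow, mul_inv_eq_iff_eq_mul]
    exact (mem_centralizer_iff.1 c.2 _ h1).symm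
  -- `C` fixes `A`, so its action on `B` is determined on the finitely many coset representatives.
  have hEfin : (E.subgroupOf C).FiniteIndex := by
    refine finiteIndex_of_eq_imp_mem (X := ∀ q : B ⧸ A', {x : B // x ^ e = q.out ^ e}) _
      (fun c q => ⟨_, hconj c q.out⟩) fun c d hcd => ?_
    rw [mem_subgroupOf, hEdef, mem_centralizer_iff]
    intro b hb
    have hq (q : B ⧸ A') : Commute (q.out : G) (c⁻¹ * d : C) := by
      have h1 : (c : G) * q.out * (c : G)⁻¹ = d * q.out * (d : G)⁻¹ :=
        congrArg (fun x => (x.1 : G)) (congrFun hcd q)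
      show (q.out : G) * ((c : G)⁻¹ * d) = (c : G)⁻¹ * d * q.out
      calc (q.out : G) * ((c : G)⁻¹ * d) = (c : G)⁻¹ * (c * q.out * (c : G)⁻¹) * d := by group
        _ = (c : G)⁻¹ * d * q.out := by rw [h1]; group
    obtain ⟨a, ha⟩ := QuotientGroup.mk_out_eq_mul A' ⟨b, hb⟩
    have h2 : b = ((QuotientGroup.mk (⟨b, hb⟩ : B) : B ⧸ A').out : G) * ((a : B) : G)⁻¹ := by
      rw [ha]; simp
    have h3 : Commute ((a : B) : G) (c⁻¹ * d : C) :=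
      mem_centralizer_iff.1 (c⁻¹ * d : C).2 _ a.2
    rw [h2]
    exact ((hq _).mul_left h3.inv_left).eq
  have := finiteIndex_of_subgroupOf hEfin
  exact finiteIndex_of_le hEA

end Irreducible

/-! ### Subspaces with virtually commutative action -/

section VirtuallyCommutative

variable {F G V : Type*} [Field F] [Group G] [AddCommGroup V] [Module F V]

/-- Some subgroup of finite index acts commutatively on the subspace `W`. -/
def IsVirtuallyCommutativeOn (ρ : Representation F G V) (W : Submodule F V) : Prop :=
  ∃ H : Subgroup G, H.FiniteIndex ∧ ∀ a ∈ H, ∀ b ∈ H, ∀ w ∈ W, ρ (a * b) w = ρ (b * a) w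

theorem IsVirtuallyCommutativeOn.sup {ρ : Representation F G V} {W₁ W₂ : Submodule F V}
    (h₁ : IsVirtuallyCommutativeOn ρ W₁) (h₂ : IsVirtuallyCommutativeOn ρ W₂) :
    IsVirtuallyCommutativeOn ρ (W₁ ⊔ W₂) := by
  obtain ⟨H₁, hf₁, h₁⟩ := h₁
  obtain ⟨H₂, hf₂, h₂⟩ := h₂
  refine ⟨H₁ ⊓ H₂, inferInstance, fun a ha b hb w hw => ?_⟩
  obtain ⟨x, hx, y, hy, rfl⟩ := Submodule.mem_sup.1 hw
  rw [map_add, map_add, h₁ a ha.1 b hb.1 x hx, h₂ a ha.2 b hb.2 y hy]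

theorem IsVirtuallyCommutativeOn.map {ρ : Representation F G V} {W : Submodule F V}
    (h : IsVirtuallyCommutativeOn ρ W) (g : G) : IsVirtuallyCommutativeOn ρ (W.map (ρ g)) := by
  obtain ⟨H, hf, h⟩ := h
  refine ⟨H.comap (MulAut.conj g⁻¹).toMonoidHom, ?_, ?_⟩
  · refine ⟨?_⟩
    rw [index_comap_of_surjective _ (MulAut.conj g⁻¹).surjective]
    exact hf.index_ne_zero
  · rintro a ha b hb _ ⟨w, hw, rfl⟩
    have h1 := congrArg (ρ g) (h _ ha _ hb w hw)
    simp only [← Module.End.mul_apply, ← map_mul] at h1 ⊢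
    convert h1 using 3 <;> simp [mul_assoc]

/-- The submodule lattice is Noetherian, so closure under binary sums suffices for the supremum;
closure under translates makes it stable. -/
theorem exists_greatest_isVirtuallyCommutativeOn [FiniteDimensional F V]
    (ρ : Representation F G V) :
    ∃ M : Submodule F V, IsVirtuallyCommutativeOn ρ M ∧ IsStable ρ ⊤ M ∧
      ∀ W, IsVirtuallyCommutativeOn ρ W → W ≤ M := by
  have h := CompleteLattice.WellFoundedGT.isSupClosedCompact (Submodule F V) inferInstance
    {W | IsVirtuallyCommutativeOn ρ W}
    ⟨⊥, ⊤, inferInstance, fun a _ b _ w hw => by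
      rw [(Submodule.mem_bot F).1 hw, map_zero, map_zero]⟩
    (fun _ h₁ _ h₂ => h₁.sup h₂)
  refine ⟨_, h, fun g _ w hw => ?_, fun W hW => le_sSup hW⟩
  have hle : (sSup {W | IsVirtuallyCommutativeOn ρ W}).map (ρ g) ≤
      sSup {W | IsVirtuallyCommutativeOn ρ W} :=
    le_sSup (a := (sSup {W | IsVirtuallyCommutativeOn ρ W}).map (ρ g))
      (IsVirtuallyCommutativeOn.map h g)
  exact hle (Submodule.mem_map_of_mem hw)

theorem exists_minimal_isStable [FiniteDimensional F V] (ρ : Representation F G V)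
    (H : Subgroup G) {U : Submodule F V} (hU : IsStable ρ H U) (hne : U ≠ ⊥) :
    ∃ W ≤ U, IsStable ρ H W ∧ W ≠ ⊥ ∧ ∀ W' ≤ W, IsStable ρ H W' → W' = ⊥ ∨ W' = W := by
  obtain ⟨W, hWU, hW⟩ := exists_minimal_le_of_wellFoundedLT
    (fun W : Submodule F V => IsStable ρ H W ∧ W ≠ ⊥) U ⟨hU, hne⟩
  refine ⟨W, hWU, hW.prop.1, hW.prop.2, fun W' hle hs => or_iff_not_imp_left.2 fun hb => ?_⟩
  exact le_antisymm hle (hW.le_of_le ⟨hs, hb⟩ hle)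

/-- The action of `H` on a stable subspace. -/
def restrictRep (ρ : Representation F G V) (H : Subgroup G) (W : Submodule F V)
    (hW : IsStable ρ H W) : Representation F H W where
  toFun h := (ρ h).restrict (hW h h.2)
  map_one' := by ext; simp
  map_mul' x y := by ext; simp

theorem actsIrreducibly_restrictRep {ρ : Representation F G V} {H : Subgroup G}
    {W : Submodule F V} (hW : IsStable ρ H W)
    (hmin : ∀ W' ≤ W, IsStable ρ H W' → W' = ⊥ ∨ W' = W) :
    ActsIrreducibly (restrictRep ρ H W hW) ⊤ := by
  intro U hU
  have h1 : IsStable ρ H (U.map W.subtype) := by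
    rintro h hh _ ⟨u, hu, rfl⟩
    exact ⟨restrictRep ρ H W hW ⟨h, hh⟩ u, hU ⟨h, hh⟩ (mem_top _) u hu, rfl⟩
  rcases hmin _ (Submodule.map_subtype_le W U) h1 with h | h
  · exact Or.inl (Submodule.map_injective_of_injective W.subtype_injective
      (by rw [h, Submodule.map_bot]))
  · refine Or.inr (Submodule.map_injective_of_injective W.subtype_injective ?_)
    rw [h, Submodule.map_subtype_top]

theorem isVirtuallyCommutativeOn_of_restrictRep {ρ : Representation F G V} {H : Subgroup G}
    [H.FiniteIndex] {W : Submodule F V} (hW : IsStable ρ H W)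
    (h : IsVirtuallyCommutativeOn (restrictRep ρ H W hW) ⊤) : IsVirtuallyCommutativeOn ρ W := by
  obtain ⟨K, hK, h⟩ := h
  refine ⟨K.map H.subtype, ?_, ?_⟩
  · refine ⟨?_⟩
    rw [index_map_subtype]
    exact mul_ne_zero hK.index_ne_zero FiniteIndex.index_ne_zero
  · rintro _ ⟨a, ha, rfl⟩ _ ⟨b, hb, rfl⟩ w hw
    exact congrArg Subtype.val (h a ha b hb ⟨w, hw⟩ Submodule.mem_top)

theorem isVirtuallyCommutativeOn_top_of_forall_actsIrreducibly [FiniteDimensional F V]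
    [Nontrivial V] [Group.IsSolvable G] {ρ : Representation F G V}
    (hρ : ∀ H : Subgroup G, H.FiniteIndex → ActsIrreducibly ρ H) :
    IsVirtuallyCommutativeOn ρ ⊤ := by
  let ρ' : Representation F (G ⧸ ρ.ker) V := QuotientGroup.lift ρ.ker ρ fun _ h => h
  have hinj : Function.Injective ρ' := by
    rw [injective_iff_map_eq_one]
    intro q hq
    obtain ⟨g, rfl⟩ := QuotientGroup.mk_surjective q
    exact (QuotientGroup.eq_one_iff g).2 hq
  obtain ⟨A, hA, hAc⟩ := exists_finiteIndex_le_centralizer hinj fun H hH W hW =>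
    hρ (H.comap (QuotientGroup.mk' ρ.ker)) (by
      refine ⟨?_⟩
      rw [index_comap_of_surjective _ (QuotientGroup.mk'_surjective _)]
      exact hH.index_ne_zero) W fun g hg w hw => hW g hg w hw
  refine ⟨A.comap (QuotientGroup.mk' ρ.ker), ?_, fun a ha b hb w _ => ?_⟩
  · refine ⟨?_⟩
    rw [index_comap_of_surjective _ (QuotientGroup.mk'_surjective _)]
    exact hA.index_ne_zero
  · exact LinearMap.congr_fun (congrArg ρ' (mem_centralizer_iff.1 (hAc hb) _ ha)) w

end VirtuallyCommutative

/-- Group and space vary in the induction, because it passes to a finite-index subgroup acting on a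
smaller subspace. -/
theorem isVirtuallyCommutativeOn_top_of_actsIrreducibly {F : Type*} [Field F] (d : ℕ) :
    ∀ {G V : Type*} [Group G] [AddCommGroup V] [Module F V] [FiniteDimensional F V]
      [Group.IsSolvable G] (ρ : Representation F G V), ActsIrreducibly ρ ⊤ →
      Module.finrank F V = d → IsVirtuallyCommutativeOn ρ ⊤ := by
  induction d using Nat.strong_induction_on with
  | _ d ih =>
    intro G V _ _ _ _ _ ρ hρ hd
    obtain ⟨M, hM, hMs, hmax⟩ := exists_greatest_isVirtuallyCommutativeOn ρ
    by_cases hall : ∀ H : Subgroup G, H.FiniteIndex → ActsIrreducibly ρ H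
    · rcases subsingleton_or_nontrivial V with hV | hV
      · exact ⟨⊤, inferInstance, fun _ _ _ _ _ _ => Subsingleton.elim _ _⟩
      · exact isVirtuallyCommutativeOn_top_of_forall_actsIrreducibly hall
    · simp only [ActsIrreducibly, not_forall, not_or] at hall
      obtain ⟨H, hH, U, hU, hUbot, hUtop⟩ := hall
      obtain ⟨W, hWU, hW, hWne, hWmin⟩ := exists_minimal_isStable ρ H hU hUbot
      have hlt : Module.finrank F W < d := by
        rw [← hd]
        exact Submodule.finrank_lt (ne_top_of_le_ne_top hUtop hWU)
      have h1 := isVirtuallyCommutativeOn_of_restrictRep hW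
        (ih _ hlt _ (actsIrreducibly_restrictRep hW hWmin) rfl)
      rcases hρ M hMs with h | h
      · exact absurd (le_bot_iff.1 (h ▸ hmax W h1)) hWne
      · rwa [h] at hM

theorem isVirtuallyCommutativeOn_top_of_exists_isCompl {F G V : Type*} [Field F] [Group G]
    [AddCommGroup V] [Module F V] [FiniteDimensional F V] {ρ : Representation F G V}
    (hρ : ∀ U, IsStable ρ ⊤ U → ∃ U', IsStable ρ ⊤ U' ∧ IsCompl U U')
    {N : Subgroup G} [N.FiniteIndex] [Group.IsSolvable N] : IsVirtuallyCommutativeOn ρ ⊤ := by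
  obtain ⟨M, hM, hMs, hmax⟩ := exists_greatest_isVirtuallyCommutativeOn ρ
  obtain ⟨U, hU, hcompl⟩ := hρ M hMs
  by_cases hbot : U = ⊥
  · rw [hbot] at hcompl
    rwa [← hcompl.sup_eq_top, sup_bot_eq]
  · obtain ⟨W, hWU, hW, hWne, hWmin⟩ := exists_minimal_isStable ρ N
      (fun g _ w hw => hU g (mem_top g) w hw) hbot
    have h1 := isVirtuallyCommutativeOn_of_restrictRep hW
      (isVirtuallyCommutativeOn_top_of_actsIrreducibly _ _
        (actsIrreducibly_restrictRep hW hWmin) rfl)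
    exact absurd (le_bot_iff.1 (hcompl.disjoint (hmax W h1) hWU)) hWne

theorem exists_isCompl_of_isSemisimpleRepresentation {F G V : Type*} [Field F] [Group G]
    [AddCommGroup V] [Module F V] {ρ : Representation F G V} (h : ρ.IsSemisimpleRepresentation)
    (U : Submodule F V) (hU : IsStable ρ ⊤ U) :
    ∃ U', IsStable ρ ⊤ U' ∧ IsCompl U U' := by
  obtain ⟨U', hU'⟩ := h.exists_isCompl
    (⟨U, fun g _ hv => hU g (mem_top g) _ hv⟩ : Subrepresentation ρ)
  refine ⟨U'.toSubmodule, fun g _ w hw => U'.apply_mem_toSubmodule g hw, ?_, ?_⟩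
  · rw [disjoint_iff]
    exact congrArg Subrepresentation.toSubmodule hU'.inf_eq_bot
  · rw [codisjoint_iff]
    exact congrArg Subrepresentation.toSubmodule hU'.sup_eq_top

theorem isAbelianByFinite_of_isVirtuallyCommutativeOn {F : Type*} [Field F] {n : ℕ}
    {G : Subgroup (Matrix.GeneralLinearGroup (Fin n) F)}
    (h : IsVirtuallyCommutativeOn (naturalRep G) ⊤) : IsAbelianByFinite G := by
  obtain ⟨H, hH, h⟩ := h
  refine ⟨H.normalCore, inferInstance, inferInstance, ⟨⟨fun a b => ?_⟩⟩⟩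
  refine Subtype.ext (Subtype.ext (Units.ext (Matrix.toLin'.injective ?_)))
  exact LinearMap.ext fun v =>
    h a (normalCore_le H a.2) b (normalCore_le H b.2) v Submodule.mem_top

end LinearGroup

theorem lemma4p1 {F : Type*} [Field F] (n : ℕ)
    (G : Subgroup (Matrix.GeneralLinearGroup (Fin n) F))
    (hG : LinearGroup.IsCompletelyReducible G) :
    List.TFAE [LinearGroup.IsSolvableByFinite G,
      LinearGroup.IsNilpotentByFinite G,
      LinearGroup.IsAbelianByFinite G] := by
  tfae_have 3 → 2 := by
    rintro ⟨N, h1, h2, h3⟩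
    let : CommGroup N := { (inferInstance : Group N) with mul_comm := h3.is_comm.comm }
    exact ⟨N, h1, h2, CommGroup.isNilpotent⟩
  tfae_have 2 → 1 := by
    rintro ⟨N, h1, h2, h3⟩
    exact ⟨N, h1, h2, inferInstance⟩
  tfae_have 1 → 3 := by
    rintro ⟨N, -, h2, h3⟩
    exact LinearGroup.isAbelianByFinite_of_isVirtuallyCommutativeOn
      (LinearGroup.isVirtuallyCommutativeOn_top_of_exists_isCompl (N := N)
        (LinearGroup.exists_isCompl_of_isSemisimpleRepresentation hG))
  tfae_finish
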